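/- All hypergraphs are finite and simple: $\mathcal G=(V,E)$ has a finite nonempty vertex set $V$ and a set $E$ of subsets of $V$. It is $k$-uniform if $|e|=k$ for every $e\in E$. Its adjacency matrix is the $V\times V$ matrix with entries $\sum_{e\in E,\ \{i,j\}\subseteq e}\frac{1}{|e|-1}$ for $i\ne j$ and with zero diagonal, and its spectral radius $\rho(\mathcal G)$ is the maximum modulus of the eigenvalues of this matrix. $\mathcal G$ is connected if any two vertices can be joined by a sequence of vertices in which consecutive ones lie in a common edge. A connected $k$-uniform hypergraph with $n$ vertices and $m$ edges is unicyclic if $n-1=(k-1)m-1$. A hypercycle of length $q\ge 2$ consists of distinct vertices $v_1,\dots,v_q$ and distinct edges $e_1,\dots,e_q$ with $v_i,v_{i+1}\in e_i$ (indices modulo $q$) such that $e_i\cap e_j=\{v_i,v_{i+1}\}\cap\{v_j,v_{j+1}\}$ for $i\neq j$ (so for $q=2$ the two edges meet in exactly $v_1,v_2$; for $q\ge 3$ cyclically consecutive edges meet in exactly one vertex and all other pairs of edges are disjoint). The girth is the length of a shortest hypercycle. For $k\ge 3$, $g\ge 2$, $(k-1)\mid n$ and $\frac{n}{k-1}\ge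 g$, let $\mathscr U^*(n,k,g)$ be the $k$-uniform hypergraph on $n$ vertices that is obtained from the $k$-uniform $g$-hypercycle $v_1e_1v_2e_2\cdots v_ge_gv_1$, in which each $e_i$ contains, besides $v_i$ and $v_{i+1}$, $k-2$ further vertices lying in no other edge, by attaching $\frac{n}{k-1}-g$ pendant edges at $v_1$; each of these consists of $v_1$ and $k-1$ new vertices lying in no other edge. **Theorem.** Let $k\ge 3$ and let $\mathcal G$ be a $k$-uniform unicyclic hypergraph of order $n$ and girth $g$. Then $\mathscr U^*(n,k,g)$ is itself a $k$-uniform unicyclic hypergraph of order $n$ and girth $g$, and $$\rho(\mathcal G)\le \rho(\mathscr U^*(n,k,g)),$$ with equality if and only if $\mathcal G\cong \mathscr U^*(n,k,g)$. -/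

import Mathlib

open scoped ENNReal Hypergraph

namespace Hypergraph

variable {α β : Type*}

/-- Every edge has exactly `k` vertices. -/
def IsUniform (H : Hypergraph α) (k : ℕ) : Prop :=
  ∀ e ∈ E(H), e.ncard = k

/-- The vertex set is nonempty and any two vertices are joined by a finite sequence of vertices
in which consecutive ones lie in a common edge. -/
def IsConnected (H : Hypergraph α) : Prop :=
  V(H).Nonempty ∧ ∀ u ∈ V(H), ∀ v ∈ V(H), Relation.ReflTransGen H.Adj u v

/-- A connected `k`-uniform hypergraph with `n` vertices and `m` edges is `r`-cyclic if
`n - 1 = (k - 1) m - r` (an equation between integers). -/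
def IsCyclicOfRank (H : Hypergraph α) (k r : ℕ) : Prop :=
  H.IsUniform k ∧ H.IsConnected ∧
    (V(H).ncard : ℤ) - 1 = ((k : ℤ) - 1) * (E(H).ncard : ℤ) - (r : ℤ)

/-- `k`-uniform unicyclic hypergraphs are the `1`-cyclic ones. -/
def IsUnicyclic (H : Hypergraph α) (k : ℕ) : Prop :=
  H.IsCyclicOfRank k 1

/-- `v₀ e₀ v₁ e₁ ⋯ v_{q-1} e_{q-1} v₀` is a hypercycle of length `q ≥ 2` in `H`
(indices are cyclic, `finRotate q i` being `i + 1` modulo `q`): the vertices are distinct,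
the edges are distinct, `vᵢ, vᵢ₊₁ ∈ eᵢ`, and two different edges meet exactly in the cycle vertices
they share.  The last clause says: for `q = 2`, the two edges meet in exactly `{v₀, v₁}`;
for `q ≥ 3`, `eᵢ ∩ eᵢ₊₁ = {vᵢ₊₁}`, and edges that are not cyclically consecutive are disjoint. -/
structure IsHypercycle (H : Hypergraph α) (q : ℕ) (v : Fin q → α) (e : Fin q → Set α) : Prop where
  two_le : 2 ≤ q
  vertex_injective : Function.Injective v
  edge_injective : Function.Injective e
  edge_mem : ∀ i, e i ∈ E(H)
  left_mem : ∀ i, v i ∈ e i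
  right_mem : ∀ i, v (finRotate q i) ∈ e i
  inter_eq : ∀ i j, i ≠ j →
    e i ∩ e j = {v i, v (finRotate q i)} ∩ {v j, v (finRotate q j)}

/-- The girth of `H` is `g`: `g` is the length of a shortest hypercycle of `H`
(in particular, `H` has a hypercycle). -/
def HasGirth (H : Hypergraph α) (g : ℕ) : Prop :=
  IsLeast {q : ℕ | ∃ (v : Fin q → α) (e : Fin q → Set α), H.IsHypercycle q v e} g

open Classical in
/-- The adjacency matrix of a finite hypergraph: the entry at `(i, j)`, `i ≠ j`, is the sum of
`1 / (|e| - 1)` over all edges `e` containing both `i` and `j`; the diagonal is zero. -/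
noncomputable def adjMatrix (H : Hypergraph α) : Matrix V(H) V(H) ℂ :=
  Matrix.of fun i j =>
    if i = j then 0
    else ∑ᶠ e ∈ {e : Set α | e ∈ E(H) ∧ (i : α) ∈ e ∧ (j : α) ∈ e}, 1 / ((e.ncard : ℂ) - 1)

open Classical in
/-- The spectral radius of a finite hypergraph: the maximum modulus of the (complex) eigenvalues
of its adjacency matrix. -/
noncomputable def specRadius (H : Hypergraph α) [Finite V(H)] : ℝ≥0∞ :=
  letI : Fintype V(H) := Fintype.ofFinite V(H)
  spectralRadius ℂ H.adjMatrix

/-- Isomorphism of hypergraphs: a bijection of the vertex sets under which the edges correspond. -/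
def IsIsomorphic (G : Hypergraph α) (H : Hypergraph β) : Prop :=
  ∃ f : V(G) ≃ V(H), ∀ s : Set V(G),
    (Subtype.val '' s ∈ E(G) ↔ Subtype.val '' (f '' s) ∈ E(H))

/-- The vertices of the `g`-hypercycle with `p` pendant edges attached:
* `Sum.inl (i, 0)` is the cycle vertex `vᵢ` (so `v₀` is the first one), and `Sum.inl (i, b)` with
  `b ≠ 0` are the `k - 2` further vertices of the cycle edge `eᵢ`;
* `Sum.inr (j, b)` are the `k - 1` new vertices of the `j`-th pendant edge. -/
abbrev UStarVertex (k g p : ℕ) : Type :=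
  (Fin g × Fin (k - 1)) ⊕ (Fin p × Fin (k - 1))

/-- The cycle edge `eᵢ = {vᵢ, (k - 2 further vertices), vᵢ₊₁}`, where `v_g = v₀`. -/
def uStarCycleEdge (k g p : ℕ) (i : Fin g) : Set (UStarVertex k g p) :=
  {x | (∃ b : Fin (k - 1), x = Sum.inl (i, b)) ∨
    ∃ b : Fin (k - 1), b.val = 0 ∧ x = Sum.inl (finRotate g i, b)}

/-- The `j`-th pendant edge: the first cycle vertex `v₀` together with `k - 1` new vertices. -/
def uStarPendantEdge (k g p : ℕ) (j : Fin p) : Set (UStarVertex k g p) :=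
  {x | (∃ (a : Fin g) (b : Fin (k - 1)), a.val = 0 ∧ b.val = 0 ∧ x = Sum.inl (a, b)) ∨
    ∃ b : Fin (k - 1), x = Sum.inr (j, b)}

/-- `U*(n, k, g)`: the `k`-uniform `g`-hypercycle with `n / (k - 1) - g` pendant edges attached at
the first cycle vertex. It is meant for `k ≥ 3`, `g ≥ 2`, `k - 1 ∣ n` and `g ≤ n / (k - 1)`. -/
def uStar (n k g : ℕ) : Hypergraph (UStarVertex k g (n / (k - 1) - g)) where
  vertexSet := Set.univ
  edgeSet := Set.range (uStarCycleEdge k g (n / (k - 1) - g)) ∪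
    Set.range (uStarPendantEdge k g (n / (k - 1) - g))
  subset_vertexSet_of_mem_edgeSet' := fun _ _ => Set.subset_univ _

end Hypergraph

/-! Let `x` be a Perron vector of `G` and `w` a vertex where `x` is largest. Replacing a vertex `z`
of an edge that misses `w` by `w` does not lower the quadratic form of the adjacency matrix at `x`,
since it changes that form by a nonnegative multiple of `x w - x z`. So the maximum of the Rayleigh
quotient, which is the spectral radius, does not drop, however many edges are moved at once. If it
stays the same, `x` is an eigenvector before and after for the same eigenvalue; but the eigenvalue
equation at `w` gains a positive term from every moved edge, so no edge was moved
(`le_of_move_edges`, `exists_vertex_specRadius_le`).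

It remains to reach `uStar` by a single round of such moves (`IsUnicyclic.exists_move`). Measure
distance from `w`. Every edge off a shortest hypercycle trades its nearest vertex for `w` and
becomes pendant at `w`. On the hypercycle, the two edges around a nearest vertex `u` are altered so
that the cycle passes through `w`. Every vertex still occurs afterwards, and since a unicyclic
hypergraph has exactly `(k - 1) * m` vertices for `m` edges, the count leaves no room for further
coincidences: the result is `uStar`.

That `uStar` has girth `g` holds because its pendant edges lie on no hypercycle
(`le_of_isHypercycle_uStar`). -/

namespace Matrix

/-! ### Perron theory through the Rayleigh quotient. -/

variable {V : Type*} [Fintype V]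

/-- The Rayleigh quotient of a real symmetric matrix attains its maximum. -/
theorem exists_max_rayleigh [Nonempty V] (A : Matrix V V ℝ) :
    ∃ (l : ℝ) (x : V → ℝ), x ≠ 0 ∧ x ⬝ᵥ A *ᵥ x = l * (x ⬝ᵥ x) ∧
      ∀ y : V → ℝ, y ⬝ᵥ A *ᵥ y ≤ l * (y ⬝ᵥ y) := by
  classical
  set S : Set (V → ℝ) := {x | x ⬝ᵥ x = 1} with hS
  have hc : IsCompact S := by
    refine Metric.isCompact_of_isClosed_isBounded ?_ ?_
    · exact isClosed_eq (by unfold dotProduct; fun_prop) continuous_const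
    · refine (Metric.isBounded_closedBall (x := (0 : V → ℝ)) (r := 1)).subset fun x hx => ?_
      rw [mem_closedBall_zero_iff, pi_norm_le_iff_of_nonneg zero_le_one]
      intro i
      have h1 : x i * x i ≤ x ⬝ᵥ x :=
        Finset.single_le_sum (f := fun i => x i * x i) (fun i _ => mul_self_nonneg _)
          (Finset.mem_univ i)
      rw [hx] at h1
      rw [Real.norm_eq_abs]
      exact abs_le_one_iff_mul_self_le_one.2 h1
  obtain ⟨i⟩ := ‹Nonempty V›
  have hne : S.Nonempty := ⟨Pi.single i 1, by simp [hS]⟩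
  obtain ⟨x, hx, hmax⟩ := hc.exists_isMaxOn hne
    (f := fun x => x ⬝ᵥ A *ᵥ x) (by unfold dotProduct mulVec dotProduct; fun_prop)
  refine ⟨x ⬝ᵥ A *ᵥ x, x, ?_, ?_, fun y => ?_⟩
  · rintro rfl
    simp [hS] at hx
  · rw [show x ⬝ᵥ x = 1 from hx, mul_one]
  · by_cases hy : y = 0
    · simp [hy]
    have hpos : 0 < y ⬝ᵥ y := by
      obtain ⟨j, hj⟩ := Function.ne_iff.1 hy
      exact Finset.sum_pos' (fun i _ => mul_self_nonneg _)
        ⟨j, Finset.mem_univ j, mul_self_pos.2 hj⟩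
    set c := (Real.sqrt (y ⬝ᵥ y))⁻¹ with hcdef
    have hcc : c * c = (y ⬝ᵥ y)⁻¹ := by
      rw [hcdef, ← mul_inv, Real.mul_self_sqrt hpos.le]
    have hmem : c • y ∈ S := by
      change (c • y) ⬝ᵥ (c • y) = 1
      rw [smul_dotProduct, dotProduct_smul, smul_eq_mul, smul_eq_mul, ← mul_assoc, hcc,
        inv_mul_cancel₀ hpos.ne']
    have := hmax hmem
    simp only [Set.mem_ofPred_eq, mulVec_smul, smul_dotProduct, dotProduct_smul, smul_eq_mul] at this
    rw [← mul_assoc, hcc, inv_mul_le_iff₀ hpos] at this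
    linarith

/-- A vector attaining an upper bound of the Rayleigh quotient of a symmetric matrix is an
eigenvector. -/
theorem mulVec_eq_of_rayleigh_eq {A : Matrix V V ℝ} (hA : A.IsSymm) {l : ℝ}
    (hl : ∀ y : V → ℝ, y ⬝ᵥ A *ᵥ y ≤ l * (y ⬝ᵥ y)) {x : V → ℝ}
    (hx : x ⬝ᵥ A *ᵥ x = l * (x ⬝ᵥ x)) : A *ᵥ x = l • x := by
  classical
  -- `l • 1 - A` is positive semidefinite, so a zero of its quadratic form lies in its kernel.
  have hP : (l • (1 : Matrix V V ℝ) - A).PosSemidef := by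
    refine PosSemidef.of_dotProduct_mulVec_nonneg ?_ fun y => ?_
    · rw [IsHermitian, conjTranspose_eq_transpose_of_trivial, transpose_sub, hA.eq,
        transpose_smul, transpose_one]
    · have := hl y
      simp only [star_trivial, sub_mulVec, smul_mulVec, one_mulVec, dotProduct_sub,
        dotProduct_smul, smul_eq_mul]
      linarith
  have := (hP.dotProduct_mulVec_zero_iff x).1 (by
    simp only [star_trivial, sub_mulVec, smul_mulVec, one_mulVec, dotProduct_sub,
      dotProduct_smul, smul_eq_mul]
    linarith)
  rw [sub_mulVec, smul_mulVec, one_mulVec, sub_eq_zero] at this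
  exact this.symm

/-- A nonnegative real symmetric matrix has a nonnegative eigenvector for its spectral radius,
which is the maximum of the Rayleigh quotient. -/
theorem exists_perron [DecidableEq V] [Nonempty V] {A : Matrix V V ℝ} (hA : A.IsSymm)
    (h0 : ∀ i j, 0 ≤ A i j) :
    ∃ l : ℝ, 0 ≤ l ∧ spectralRadius ℂ (A.map ((↑) : ℝ → ℂ)) = ENNReal.ofReal l ∧
      (∀ y : V → ℝ, y ⬝ᵥ A *ᵥ y ≤ l * (y ⬝ᵥ y)) ∧
      ∃ x : V → ℝ, x ≠ 0 ∧ (∀ i, 0 ≤ x i) ∧ A *ᵥ x = l • x := by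
  obtain ⟨l, z, hz, hzl, hl⟩ := exists_max_rayleigh A
  -- With nonnegative entries, passing to absolute values keeps the norm and cannot lower the form,
  -- so `|z|` is again a maximizer.
  set x : V → ℝ := fun i => |z i| with hxdef
  have hxx : x ⬝ᵥ x = z ⬝ᵥ z := by simp [hxdef, dotProduct]
  have hle : z ⬝ᵥ A *ᵥ z ≤ x ⬝ᵥ A *ᵥ x := by
    simp only [dotProduct, mulVec, Finset.mul_sum]
    refine Finset.sum_le_sum fun i _ => Finset.sum_le_sum fun j _ => ?_
    calc z i * (A i j * z j) ≤ |z i * (A i j * z j)| := le_abs_self _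
      _ = x i * (A i j * x j) := by rw [abs_mul, abs_mul, abs_of_nonneg (h0 i j)]
  have hxeq : A *ᵥ x = l • x := by
    refine mulVec_eq_of_rayleigh_eq hA hl (le_antisymm (hl x) ?_)
    rw [hxx, ← hzl]
    exact hle
  have hx0 : x ≠ 0 := by
    obtain ⟨j, hj⟩ := Function.ne_iff.1 hz
    exact Function.ne_iff.2 ⟨j, by simpa [hxdef] using hj⟩
  have hpos : ∀ y : V → ℝ, y ≠ 0 → 0 < y ⬝ᵥ y := by
    intro y hy
    obtain ⟨j, hj⟩ := Function.ne_iff.1 hy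
    exact Finset.sum_pos' (fun i _ => mul_self_nonneg _)
      ⟨j, Finset.mem_univ j, mul_self_pos.2 hj⟩
  have hl0 : 0 ≤ l := by
    have h1 : 0 ≤ x ⬝ᵥ A *ᵥ x :=
      Finset.sum_nonneg fun i _ => mul_nonneg (abs_nonneg _)
        (Finset.sum_nonneg fun j _ => mul_nonneg (h0 i j) (abs_nonneg _))
    rw [hxeq, dotProduct_smul, smul_eq_mul] at h1
    exact nonneg_of_mul_nonneg_left h1 (hpos x hx0)
  refine ⟨l, hl0, le_antisymm ?_ ?_, hl, x, hx0, fun i => abs_nonneg _, hxeq⟩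
  · refine iSup₂_le fun μ hμ => ?_
    rw [← spectrum_toLin', ← Module.End.hasEigenvalue_iff_mem_spectrum] at hμ
    obtain ⟨c, hc⟩ := hμ.exists_hasEigenvector
    have hev : A.map ((↑) : ℝ → ℂ) *ᵥ c = μ • c := hc.apply_eq_smul
    have hc0 := hc.2
    -- By the triangle inequality the moduli satisfy `‖μ‖ • y ≤ A *ᵥ y` entrywise, so the Rayleigh
    -- bound applies to `‖μ‖`.
    set y : V → ℝ := fun i => ‖c i‖ with hy
    have hy0 : y ≠ 0 := by
      obtain ⟨j, hj⟩ := Function.ne_iff.1 hc0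
      exact Function.ne_iff.2 ⟨j, by simpa [hy] using hj⟩
    have h1 : ‖μ‖ * (y ⬝ᵥ y) ≤ y ⬝ᵥ A *ᵥ y := by
      rw [← smul_eq_mul, ← dotProduct_smul]
      refine Finset.sum_le_sum fun i _ => mul_le_mul_of_nonneg_left ?_ (norm_nonneg _)
      have := congrFun hev i
      calc (‖μ‖ • y) i = ‖(μ • c) i‖ := by simp [hy]
        _ = ‖∑ j, (A i j : ℂ) * c j‖ := by rw [← this]; rfl
        _ ≤ ∑ j, A i j * y j := by
          refine (norm_sum_le _ _).trans (Finset.sum_le_sum fun j _ => ?_)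
          rw [norm_mul, Complex.norm_of_nonneg (h0 i j)]
    have h2 : ‖μ‖ ≤ l := le_of_mul_le_mul_right (h1.trans (hl y)) (hpos y hy0)
    exact ENNReal.coe_le_coe.2 (NNReal.le_toNNReal_of_coe_le h2)
  · have hmem : (l : ℂ) ∈ spectrum ℂ (A.map ((↑) : ℝ → ℂ)) := by
      rw [← spectrum_toLin']
      refine Module.End.HasEigenvalue.mem_spectrum
        (Module.End.hasEigenvalue_of_hasEigenvector (x := fun i => (x i : ℂ)) ⟨?_, ?_⟩)
      · rw [Module.End.mem_eigenspace_iff, toLin'_apply]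
        ext i
        have := congrFun hxeq i
        simp only [mulVec, dotProduct, Pi.smul_apply, smul_eq_mul, map_apply] at this ⊢
        exact_mod_cast this
      · obtain ⟨j, hj⟩ := Function.ne_iff.1 hx0
        exact Function.ne_iff.2 ⟨j, by simpa using hj⟩
    have := le_iSup₂ (f := fun (μ : ℂ) (_ : μ ∈ spectrum ℂ (A.map ((↑) : ℝ → ℂ))) =>
      (‖μ‖₊ : ℝ≥0∞)) _ hmem
    refine le_trans (le_of_eq ?_) this
    simp only [ENNReal.ofReal, ENNReal.coe_inj]
    ext
    rw [Real.coe_toNNReal _ hl0, coe_nnnorm, Complex.norm_of_nonneg hl0]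

end Matrix

/-! ### Quadratic forms of edge families and the effect of moving edges. -/

section EdgeFamily

open Matrix

variable {V ι : Type*} [DecidableEq V] [Fintype ι]

/-- The adjacency matrix of a finite family of edges, every edge contributing the weight `c`
to all pairs of distinct vertices it contains. -/
def familyMatrix (c : ℝ) (s : ι → Finset V) : Matrix V V ℝ :=
  Matrix.of fun i j => if i = j then 0 else ∑ t, if i ∈ s t ∧ j ∈ s t then c else 0

theorem familyMatrix_isSymm (c : ℝ) (s : ι → Finset V) : (familyMatrix c s).IsSymm := by
  ext i j
  simp only [familyMatrix, Matrix.transpose_apply, Matrix.of_apply, eq_comm, and_comm]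

theorem familyMatrix_nonneg {c : ℝ} (hc : 0 ≤ c) (s : ι → Finset V) (i j : V) :
    0 ≤ familyMatrix c s i j := by
  simp only [familyMatrix, Matrix.of_apply]
  split_ifs
  · rfl
  · exact Finset.sum_nonneg fun t _ => by split_ifs <;> simp [hc]

variable [Fintype V]

theorem familyMatrix_mulVec (c : ℝ) (s : ι → Finset V) (x : V → ℝ) (i : V) :
    (familyMatrix c s *ᵥ x) i = c * ∑ t, if i ∈ s t then ∑ j ∈ (s t).erase i, x j else 0 := by
  simp only [familyMatrix, Matrix.mulVec, dotProduct, Matrix.of_apply, ite_mul, zero_mul,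
    Finset.sum_mul]
  rw [Finset.mul_sum]
  calc ∑ j, (if i = j then 0 else ∑ t, if i ∈ s t ∧ j ∈ s t then c * x j else 0)
      = ∑ j, ∑ t, (if i ∈ s t ∧ j ∈ (s t).erase i then c * x j else 0) := by
        refine Finset.sum_congr rfl fun j _ => ?_
        by_cases h : i = j
        · subst h; simp
        · rw [if_neg h]
          refine Finset.sum_congr rfl fun t _ => ?_
          simp only [Finset.mem_erase, ne_eq, Ne.symm h, not_false_eq_true, true_and]
    _ = _ := by
        rw [Finset.sum_comm]
        refine Finset.sum_congr rfl fun t _ => ?_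
        by_cases h : i ∈ s t
        · simp only [h, true_and, if_true, Finset.mul_sum]
          rw [← Finset.sum_filter, Finset.filter_mem_eq_inter, Finset.univ_inter]
        · simp [h]

/-- An edge contributes the products over ordered pairs of its distinct vertices, that is, the
square of the sum minus the sum of squares. In this form the exchange of one vertex is easy to
follow. -/
theorem dotProduct_familyMatrix_mulVec (c : ℝ) (s : ι → Finset V) (x : V → ℝ) :
    x ⬝ᵥ familyMatrix c s *ᵥ x = c * ∑ t, ((∑ j ∈ s t, x j) ^ 2 - ∑ j ∈ s t, x j ^ 2) := by
  simp only [dotProduct, familyMatrix_mulVec]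
  simp only [← mul_assoc, mul_comm _ c]
  simp only [mul_assoc]
  rw [← Finset.mul_sum]
  congr 1
  simp only [Finset.mul_sum]
  rw [Finset.sum_comm]
  refine Finset.sum_congr rfl fun t _ => ?_
  rw [sq, Finset.sum_mul, ← Finset.sum_sub_distrib]
  simp only [mul_ite, mul_zero]
  rw [← Finset.sum_filter, Finset.filter_mem_eq_inter, Finset.univ_inter]
  refine Finset.sum_congr rfl fun i hi => ?_
  rw [← Finset.add_sum_erase _ _ hi]
  ring

/-- A zero spreads: where `x` vanishes, the eigenvalue equation makes a sum of nonnegative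
neighbouring entries zero, and connectedness carries this to every vertex. -/
theorem perron_pos {c : ℝ} (hc : 0 < c) {s : ι → Finset V} {x : V → ℝ} {l : ℝ}
    (hconn : ∀ i j, Relation.ReflTransGen (fun i j => ∃ t, i ∈ s t ∧ j ∈ s t) i j)
    (h0 : ∀ i, 0 ≤ x i) (hx : x ≠ 0) (hl : familyMatrix c s *ᵥ x = l • x) (i : V) : 0 < x i := by
  refine lt_of_le_of_ne (h0 i) fun hi => hx ?_
  have key : ∀ j, x j = 0 := by
    intro j
    induction hconn i j with
    | refl => exact hi.symm
    | @tail a b _ hab ih =>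
      obtain ⟨t, ha, hb⟩ := hab
      by_cases hne : b = a
      · rw [hne, ih]
      have h1 := congrFun hl a
      rw [familyMatrix_mulVec, Pi.smul_apply, ih, smul_zero] at h1
      have h2 := (mul_eq_zero.1 h1).resolve_left hc.ne'
      rw [Finset.sum_eq_zero_iff_of_nonneg] at h2
      · have h3 := h2 t (Finset.mem_univ t)
        rw [if_pos ha, Finset.sum_eq_zero_iff_of_nonneg fun _ _ => h0 _] at h3
        exact h3 b (Finset.mem_erase.2 ⟨hne, hb⟩)
      · intro t _
        split_ifs
        · exact Finset.sum_nonneg fun _ _ => h0 _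
        · rfl
  exact funext key

/-- Moving edges to a vertex of maximal Perron weight increases the spectral radius, strictly so if
some edge is changed. -/
theorem le_of_move_edges {c : ℝ} (hc : 0 < c) {s s' : ι → Finset V} {x : V → ℝ} {l l' : ℝ}
    (hpos : ∀ i, 0 < x i) {w : V} (hw : ∀ i, x i ≤ x w)
    (hmove : ∀ t, s' t = s t ∨ w ∉ s t ∧ ∃ z ∈ s t, s' t = insert w ((s t).erase z))
    (hcard : ∀ t, 2 ≤ (s t).card) (hl : familyMatrix c s *ᵥ x = l • x)
    (hl' : ∀ y : V → ℝ, y ⬝ᵥ familyMatrix c s' *ᵥ y ≤ l' * (y ⬝ᵥ y)) :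
    l ≤ l' ∧ (l = l' → s' = s) := by
  have hxx : 0 < x ⬝ᵥ x :=
    Finset.sum_pos' (fun i _ => mul_self_nonneg _)
      ⟨w, Finset.mem_univ w, mul_pos (hpos w) (hpos w)⟩
  have hle : x ⬝ᵥ familyMatrix c s *ᵥ x ≤ x ⬝ᵥ familyMatrix c s' *ᵥ x := by
    rw [dotProduct_familyMatrix_mulVec, dotProduct_familyMatrix_mulVec]
    refine mul_le_mul_of_nonneg_left (Finset.sum_le_sum fun t _ => ?_) hc.le
    obtain h | ⟨hwt, z, hz, h⟩ := hmove t
    · rw [h]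
    · have hw' : w ∉ (s t).erase z := fun h => hwt (Finset.mem_of_mem_erase h)
      rw [h, Finset.sum_insert hw', Finset.sum_insert hw', ← Finset.add_sum_erase _ _ hz,
        ← Finset.add_sum_erase (s t) (fun j => x j ^ 2) hz]
      have h1 : 0 ≤ ∑ j ∈ (s t).erase z, x j := Finset.sum_nonneg fun j _ => (hpos j).le
      -- The term of the edge grows by `2 * (x w - x z)` times the sum over its other vertices.
      nlinarith [mul_le_mul_of_nonneg_right (hw z) h1]
  have hls : x ⬝ᵥ familyMatrix c s *ᵥ x = l * (x ⬝ᵥ x) := by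
    rw [hl, dotProduct_smul, smul_eq_mul]
  refine ⟨le_of_mul_le_mul_right (hls ▸ hle.trans (hl' x)) hxx, fun heq => ?_⟩
  subst heq
  have hl2 : familyMatrix c s' *ᵥ x = l • x :=
    Matrix.mulVec_eq_of_rayleigh_eq (familyMatrix_isSymm c s') hl'
      (le_antisymm (hl' x) (hls ▸ hle))
  -- Both eigenvalue equations have the same value at `w`, yet edges are only gained there, each
  -- with a positive contribution.
  have hsum := (congrFun hl2 w).trans (congrFun hl w).symm
  rw [familyMatrix_mulVec, familyMatrix_mulVec] at hsum
  replace hsum := mul_left_cancel₀ hc.ne' hsum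
  by_contra hne
  obtain ⟨t, ht⟩ := Function.ne_iff.1 hne
  refine absurd hsum (ne_of_gt (Finset.sum_lt_sum (fun r _ => ?_) ⟨t, Finset.mem_univ t, ?_⟩))
  · obtain h | ⟨hwt, -⟩ := hmove r
    · rw [h]
    · rw [if_neg hwt]
      split_ifs
      · exact Finset.sum_nonneg fun j _ => (hpos j).le
      · rfl
  · obtain h | ⟨hwt, z, hz, h⟩ := hmove t
    · exact absurd h ht
    · rw [if_neg hwt, h, if_pos (Finset.mem_insert_self _ _), Finset.erase_insert
        (fun h => hwt (Finset.mem_of_mem_erase h))]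
      refine Finset.sum_pos (fun j _ => hpos j) (Finset.card_pos.1 ?_)
      have := hcard t
      rw [Finset.card_erase_of_mem hz]
      omega

theorem familyMatrix_map_equiv {W : Type*} [Fintype W] [DecidableEq W] (c : ℝ) (s : ι → Finset V)
    (f : V ≃ W) :
    familyMatrix c (fun t => (s t).map f.toEmbedding) =
      Matrix.reindexAlgEquiv ℝ ℝ f (familyMatrix c s) := by
  ext i j
  simp [familyMatrix, Matrix.coe_reindexAlgEquiv, Matrix.reindex_apply, Finset.mem_map_equiv]

theorem spectralRadius_familyMatrix_map_equiv {W : Type*} [Fintype W] [DecidableEq W] (c : ℝ)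
    (s : ι → Finset V) (f : V ≃ W) :
    spectralRadius ℂ ((familyMatrix c fun t => (s t).map f.toEmbedding).map ((↑) : ℝ → ℂ)) =
      spectralRadius ℂ ((familyMatrix c s).map ((↑) : ℝ → ℂ)) := by
  have h : (familyMatrix c fun t => (s t).map f.toEmbedding).map ((↑) : ℝ → ℂ) =
      Matrix.reindexAlgEquiv ℂ ℂ f ((familyMatrix c s).map ((↑) : ℝ → ℂ)) := by
    rw [familyMatrix_map_equiv]
    rfl
  rw [h, spectralRadius, spectralRadius, AlgEquiv.spectrum_eq]

end EdgeFamily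

/-! ### From hypergraphs to edge families; comparison of spectral radii. -/

namespace Hypergraph

variable {α β : Type*}

/-- An enumeration of the edges of `H` without repetitions. -/
structure IsEdgeFamily {ι : Type*} (H : Hypergraph α) (s : ι → Set α) : Prop where
  injective : Function.Injective s
  range_eq : Set.range s = E(H)

open Classical in
/-- The trace of a family of sets on the vertex set, as finsets of vertices. -/
noncomputable def traceFamily {ι : Type*} (H : Hypergraph α) [Fintype V(H)] (s : ι → Set α)
    (t : ι) : Finset V(H) :=
  Finset.univ.filter fun v => (v : α) ∈ s t

section

variable {ι : Type*} {H : Hypergraph α} {s : ι → Set α}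

theorem IsEdgeFamily.mem (hs : H.IsEdgeFamily s) (t : ι) : s t ∈ E(H) :=
  hs.range_eq ▸ Set.mem_range_self t

variable [Fintype V(H)]

theorem mem_traceFamily {t : ι} {v : V(H)} : v ∈ H.traceFamily s t ↔ (v : α) ∈ s t := by
  simp [traceFamily]

theorem coe_traceFamily (t : ι) : (H.traceFamily s t : Set V(H)) = Subtype.val ⁻¹' s t := by
  ext; simp [traceFamily]

theorem IsEdgeFamily.image_traceFamily (hs : H.IsEdgeFamily s) (t : ι) :
    Subtype.val '' (H.traceFamily s t : Set V(H)) = s t := by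
  rw [coe_traceFamily, Subtype.image_preimage_coe, Set.inter_eq_right]
  exact (hs.mem t).subset_vertexSet

theorem IsEdgeFamily.card_traceFamily (hs : H.IsEdgeFamily s) (t : ι) :
    (H.traceFamily s t).card = (s t).ncard := by
  rw [← hs.image_traceFamily t, Set.ncard_image_of_injective _ Subtype.val_injective,
    Set.ncard_coe_finset]

theorem IsEdgeFamily.adjMatrix_eq [DecidableEq V(H)] [Fintype ι] {k : ℕ} (hs : H.IsEdgeFamily s)
    (hk : H.IsUniform k) :
    H.adjMatrix = (familyMatrix (1 / ((k : ℝ) - 1)) (H.traceFamily s)).map ((↑) : ℝ → ℂ) := by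
  classical
  ext i j
  simp only [adjMatrix, familyMatrix, Matrix.of_apply, Matrix.map_apply]
  split_ifs with h
  · simp
  · have hS : {e : Set α | e ∈ E(H) ∧ (i : α) ∈ e ∧ (j : α) ∈ e} =
        s '' {t | (i : α) ∈ s t ∧ (j : α) ∈ s t} := by
      ext e
      simp only [← hs.range_eq, Set.mem_ofPred_eq, Set.mem_image, Set.mem_range]
      constructor
      · rintro ⟨⟨t, rfl⟩, h⟩
        exact ⟨t, h, rfl⟩
      · rintro ⟨t, h, rfl⟩
        exact ⟨⟨t, rfl⟩, h⟩
    rw [hS, finsum_mem_image hs.injective.injOn, finsum_mem_def, finsum_eq_sum_of_fintype]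
    push_cast
    refine Finset.sum_congr rfl fun t _ => ?_
    simp only [Set.indicator_apply, Set.mem_ofPred_eq, mem_traceFamily, hk _ (hs.mem t)]
    split_ifs <;> simp

theorem IsEdgeFamily.specRadius_eq [Finite V(H)] [DecidableEq V(H)] [Fintype ι] {k : ℕ}
    (hs : H.IsEdgeFamily s) (hk : H.IsUniform k) :
    H.specRadius = spectralRadius ℂ
      ((familyMatrix (1 / ((k : ℝ) - 1)) (H.traceFamily s)).map ((↑) : ℝ → ℂ)) := by
  rw [← hs.adjMatrix_eq hk, specRadius]
  congr!

/-- The matrix depends on the edge set alone, so a Perron vector found for one enumeration serves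
for any other. -/
theorem IsEdgeFamily.familyMatrix_eq {κ : Type*} [DecidableEq V(H)] [Fintype ι] [Fintype κ]
    {s' : κ → Set α} {k : ℕ}
    (hs : H.IsEdgeFamily s) (hs' : H.IsEdgeFamily s') (hk : H.IsUniform k) :
    familyMatrix (1 / ((k : ℝ) - 1)) (H.traceFamily s) =
      familyMatrix (1 / ((k : ℝ) - 1)) (H.traceFamily s') :=
  Matrix.map_injective Complex.ofReal_injective
    ((hs.adjMatrix_eq hk).symm.trans (hs'.adjMatrix_eq hk))

end

theorem isEdgeFamily_val (H : Hypergraph α) : H.IsEdgeFamily fun e : E(H) => (e : Set α) :=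
  ⟨Subtype.val_injective, Subtype.range_coe⟩

theorem finite_edgeSet (H : Hypergraph α) [Finite V(H)] : E(H).Finite :=
  (Set.Finite.finite_subsets (Set.toFinite V(H))).subset fun _ he => he.subset_vertexSet

/-- Isomorphic uniform hypergraphs have the same spectral radius. -/
theorem IsIsomorphic.specRadius_eq {G : Hypergraph α} {H : Hypergraph β} [Finite V(G)]
    [Finite V(H)] {k : ℕ} (hG : G.IsUniform k) (hH : H.IsUniform k) (h : G.IsIsomorphic H) :
    G.specRadius = H.specRadius := by
  classical
  obtain ⟨f, hf⟩ := h
  let _ := Fintype.ofFinite V(G)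
  let _ := Fintype.ofFinite V(H)
  have := G.finite_edgeSet.fintype
  set s : E(G) → Set α := fun e => e
  have hs : G.IsEdgeFamily s := G.isEdgeFamily_val
  set s' : E(G) → Set β := fun e => Subtype.val '' (f '' (Subtype.val ⁻¹' (e : Set α)))
  have himg : ∀ e : E(G), Subtype.val '' (Subtype.val ⁻¹' (e : Set α) : Set V(G)) = e := by
    intro e
    rw [Subtype.image_preimage_coe, Set.inter_eq_right]
    exact e.2.subset_vertexSet
  have hs' : H.IsEdgeFamily s' := by
    constructor
    · intro e e' h
      have h1 := (Set.image_injective.2 f.injective) (Set.image_injective.2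
        Subtype.val_injective h)
      rw [Subtype.ext_iff, ← himg e, ← himg e', h1]
    · ext d
      constructor
      · rintro ⟨e, rfl⟩
        exact (hf _).1 ((himg e).symm ▸ e.2)
      · intro hd
        have h1 : Subtype.val '' (f '' (f ⁻¹' (Subtype.val ⁻¹' d))) = d := by
          rw [Set.image_preimage_eq _ f.surjective, Subtype.image_preimage_coe, Set.inter_eq_right]
          exact hd.subset_vertexSet
        have h2 := (hf (f ⁻¹' (Subtype.val ⁻¹' d))).2 (h1.symm ▸ hd)
        refine ⟨⟨_, h2⟩, ?_⟩
        simp only [s', Set.preimage_image_eq _ Subtype.val_injective]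
        exact h1
  rw [hs.specRadius_eq hG, hs'.specRadius_eq hH, ← spectralRadius_familyMatrix_map_equiv _ _ f]
  congr! with e
  ext v
  simp only [Finset.mem_map_equiv, mem_traceFamily, s, s', Set.mem_image, Set.mem_preimage]
  constructor
  · intro h
    exact ⟨v, ⟨_, h, by simp⟩, rfl⟩
  · rintro ⟨v', ⟨u, hu, rfl⟩, hv⟩
    rw [← Subtype.ext hv]
    simpa using hu

/-- The vertex `w` is one of maximal Perron weight. It depends on `G` only and is quantified first
because the moves are designed around it. The map `φ` transports `H` to the vertex set of `G`, where
the two families can be compared. -/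
theorem exists_vertex_specRadius_le {G : Hypergraph α} [Finite V(G)] {k : ℕ} (hk : 2 ≤ k)
    (hG : G.IsUniform k) (hconn : G.IsConnected) {H : Hypergraph β} [Finite V(H)]
    (hH : H.IsUniform k) :
    ∃ w ∈ V(G), ∀ (ι : Type) (_ : Fintype ι) (s : ι → Set α) (s' : ι → Set β) (φ : β → α),
      G.IsEdgeFamily s → H.IsEdgeFamily s' → Set.BijOn φ V(H) V(G) →
      (∀ t, φ '' s' t = s t ∨ w ∉ s t ∧ ∃ z ∈ s t, φ '' s' t = insert w (s t \ {z})) →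
      G.specRadius ≤ H.specRadius ∧ (G.specRadius = H.specRadius → G.IsIsomorphic H) := by
  classical
  let _ := Fintype.ofFinite V(G)
  let _ := Fintype.ofFinite V(H)
  have : Nonempty V(G) := hconn.1.to_subtype
  have := G.finite_edgeSet.fintype
  have hc : (0 : ℝ) < 1 / ((k : ℝ) - 1) := by
    have : (2 : ℝ) ≤ k := by exact_mod_cast hk
    exact one_div_pos.2 (by linarith)
  obtain ⟨l, hl0, hspec, hl, x, hx0, hx, hev⟩ := Matrix.exists_perron
    (familyMatrix_isSymm (1 / ((k : ℝ) - 1)) (G.traceFamily fun e : E(G) => (e : Set α)))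
    (familyMatrix_nonneg hc.le _)
  rw [← G.isEdgeFamily_val.specRadius_eq hG] at hspec
  have hpos := perron_pos hc (fun i j => by
    have h1 := hconn.2 i i.2 j j.2
    obtain ⟨i, hi⟩ := i
    obtain ⟨j, hj⟩ := j
    simp only at h1
    induction h1 with
    | refl => exact .refl
    | @tail a b _ hab ih =>
      obtain ⟨e, he, ha, hb⟩ := hab
      exact (ih (he.subset_vertexSet ha)).tail
        ⟨⟨e, he⟩, mem_traceFamily.2 ha, mem_traceFamily.2 hb⟩) hx hx0 hev
  obtain ⟨w, hw⟩ := Finite.exists_max x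
  refine ⟨w, w.2, fun ι _ s s' φ hs hs' hφ hmove => ?_⟩
  let f : V(H) ≃ V(G) := hφ.equiv
  have : Nonempty V(H) := ⟨f.symm w⟩
  have hf : ∀ v, (f v : α) = φ v := fun v => rfl
  obtain ⟨l', hl0', hspec', hl', -⟩ := Matrix.exists_perron
    (familyMatrix_isSymm (1 / ((k : ℝ) - 1)) fun t => (H.traceFamily s' t).map f.toEmbedding)
    (familyMatrix_nonneg hc.le _)
  rw [spectralRadius_familyMatrix_map_equiv, ← hs'.specRadius_eq hH] at hspec'
  have hmem : ∀ t (v : V(G)), v ∈ (H.traceFamily s' t).map f.toEmbedding ↔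
      (v : α) ∈ φ '' s' t := by
    intro t v
    rw [Finset.mem_map_equiv, mem_traceFamily]
    constructor
    · intro h
      exact ⟨_, h, by rw [← hf]; simp⟩
    · rintro ⟨b, hb, hbv⟩
      have hbV := (hs'.mem t).subset_vertexSet hb
      have : f ⟨b, hbV⟩ = v := Subtype.ext hbv
      rw [← this]
      simpa using hb
  rw [G.isEdgeFamily_val.familyMatrix_eq hs hG] at hev
  obtain ⟨h1, h2⟩ := le_of_move_edges hc (s := G.traceFamily s)
    (s' := fun t => (H.traceFamily s' t).map f.toEmbedding) hpos hw (fun t => by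
      obtain h | ⟨hwt, z, hz, h⟩ := hmove t
      · left
        ext v
        rw [hmem, h, mem_traceFamily]
      · refine Or.inr ⟨by rwa [mem_traceFamily], ⟨z, (hs.mem t).subset_vertexSet hz⟩,
          by rwa [mem_traceFamily], ?_⟩
        ext v
        rw [hmem, h]
        simp only [Set.mem_insert_iff, Set.mem_sdiff, Set.mem_singleton_iff, Finset.mem_insert,
          Finset.mem_erase, mem_traceFamily, Subtype.ext_iff, ne_eq]
        tauto)
    (fun t => by rw [hs.card_traceFamily, hG _ (hs.mem t)]; exact hk) hev hl'
  rw [hspec, hspec']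
  refine ⟨ENNReal.ofReal_le_ofReal h1, fun heq => ?_⟩
  have h3 := h2 ((ENNReal.ofReal_eq_ofReal_iff hl0 hl0').1 heq)
  have h4 : ∀ t, φ '' s' t = s t := by
    intro t
    have h5 := congrFun h3 t
    ext v
    constructor
    · rintro ⟨b, hb, rfl⟩
      have hbV := hφ.mapsTo ((hs'.mem t).subset_vertexSet hb)
      have := (hmem t ⟨φ b, hbV⟩).2 ⟨b, hb, rfl⟩
      rw [h5, mem_traceFamily] at this
      exact this
    · intro hv
      have hvV := (hs.mem t).subset_vertexSet hv
      refine (hmem t ⟨v, hvV⟩).1 ?_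
      rw [h5, mem_traceFamily]
      exact hv
  have hback : ∀ r : Set V(G), φ '' (Subtype.val '' (f.symm '' r)) = Subtype.val '' r := by
    intro r
    rw [Set.image_image, Set.image_image]
    refine Set.image_congr fun v _ => ?_
    rw [← hf, Equiv.apply_symm_apply]
  refine ⟨f.symm, fun r => ?_⟩
  rw [← hs.range_eq, ← hs'.range_eq]
  constructor
  · rintro ⟨t, ht⟩
    refine ⟨t, ?_⟩
    rw [← h4, ← hback] at ht
    refine (hφ.injOn.image_eq_image_iff (hs'.mem t).subset_vertexSet ?_).1 ht
    rintro _ ⟨v, -, rfl⟩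
    exact v.2
  · rintro ⟨t, ht⟩
    exact ⟨t, by rw [← h4, ht, hback]⟩

end Hypergraph

/-! ### Turning a unicyclic hypergraph into `uStar` by moves towards `w`. -/

namespace Hypergraph

variable {α β : Type*}

/-- In a connected hypergraph there is a rank function on the vertices, such as the distance to
`w`, for which every vertex other than `w` has a neighbour of smaller rank. -/
theorem IsConnected.exists_rank {H : Hypergraph α} (h : H.IsConnected) {w : α} (hw : w ∈ V(H)) :
    ∃ d : α → ℕ, d w = 0 ∧ ∀ x ∈ V(H), x ≠ w → ∃ e ∈ E(H), x ∈ e ∧ ∃ y ∈ e, d y < d x := by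
  classical
  -- `R n` consists of the ends of walks of length `n` from `w`; the rank is the least such `n`.
  let R : ℕ → Set α := fun n => Nat.rec {w} (fun _ S => {x | ∃ y ∈ S, H.Adj y x}) n
  have hR : ∀ x ∈ V(H), ∃ n, x ∈ R n := by
    intro x hx
    induction h.2 w hw x hx with
    | refl => exact ⟨0, rfl⟩
    | @tail a b _ hab ih =>
      obtain ⟨n, hn⟩ := ih (by
        obtain ⟨e, he, ha, -⟩ := hab
        exact he.subset_vertexSet ha)
      exact ⟨n + 1, a, hn, hab⟩
  refine ⟨fun x => sInf {n | x ∈ R n}, Nat.sInf_eq_zero.2 (Or.inl rfl), fun x hx hxw => ?_⟩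
  have hmem : x ∈ R (sInf {n | x ∈ R n}) := Nat.sInf_mem (s := {n | x ∈ R n}) (hR x hx)
  generalize hn : sInf {n | x ∈ R n} = n at hmem
  cases n with
  | zero => exact absurd hmem hxw
  | succ n =>
    obtain ⟨y, hy, e, he, hye, hxe⟩ := hmem
    refine ⟨e, he, hxe, y, hye, ?_⟩
    have : sInf {n | y ∈ R n} ≤ n := Nat.sInf_le hy
    simp only [hn]
    omega

theorem finRotate_ne_self {q : ℕ} (hq : 2 ≤ q) (i : Fin q) : finRotate q i ≠ i := by
  obtain ⟨m, rfl⟩ : ∃ m, q = m + 2 := ⟨q - 2, by omega⟩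
  rw [finRotate_apply]
  simp

section Hypercycle

variable {H : Hypergraph α} {q : ℕ} {v : Fin q → α} {e : Fin q → Set α}

theorem IsHypercycle.rotate (h : H.IsHypercycle q v e) (a z : Fin q) :
    ∃ (v' : Fin q → α) (e' : Fin q → Set α), H.IsHypercycle q v' e' ∧
      Set.range e' = Set.range e ∧ e' z = e a ∧ v' (finRotate q z) = v (finRotate q a) := by
  obtain ⟨m, rfl⟩ : ∃ m, q = m + 1 := ⟨q - 1, by have := h.two_le; omega⟩
  let σ : Fin (m + 1) ≃ Fin (m + 1) := Equiv.addRight (a - z)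
  have hσ : ∀ i, finRotate (m + 1) (σ i) = σ (finRotate (m + 1) i) := by
    intro i
    simp only [finRotate_apply, σ, Equiv.coe_addRight]
    abel
  refine ⟨v ∘ σ, e ∘ σ, ⟨h.two_le, h.vertex_injective.comp σ.injective,
    h.edge_injective.comp σ.injective, fun i => h.edge_mem _, fun i => h.left_mem _, fun i => ?_,
    fun i j hij => ?_⟩, σ.surjective.range_comp e, ?_, ?_⟩
  · simp only [Function.comp_apply, ← hσ]
    exact h.right_mem _
  · simp only [Function.comp_apply, ← hσ]
    exact h.inter_eq _ _ (σ.injective.ne hij)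
  · simp [σ]
  · simp only [Function.comp_apply, ← hσ]
    simp [σ]

theorem IsHypercycle.next_ne (h : H.IsHypercycle q v e) (i : Fin q) : v (finRotate q i) ≠ v i :=
  h.vertex_injective.ne (finRotate_ne_self h.two_le i)

/-- Every vertex of a hypercycle lies in an edge of which it is not the end vertex. -/
theorem IsHypercycle.exists_mem_ne (h : H.IsHypercycle q v e) {x : α} {i : Fin q}
    (hx : x ∈ e i) : ∃ j, x ∈ e j ∧ x ≠ v (finRotate q j) := by
  by_cases hxi : x = v (finRotate q i)
  · exact ⟨finRotate q i, hxi ▸ h.left_mem _, hxi ▸ (h.next_ne _).symm⟩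
  · exact ⟨i, hx, hxi⟩

end Hypercycle

theorem exists_enumeration {r : ℕ} {D : Set α} {x : α} (hx : x ∈ D) (hr : 0 < r)
    (hD : D.ncard = r) :
    ∃ h : Fin r → α, (∀ b : Fin r, b.val = 0 → h b = x) ∧ Set.range h = D := by
  obtain ⟨r, rfl⟩ : ∃ m, r = m + 1 := ⟨r - 1, by omega⟩
  have hfin : D.Finite := Set.finite_of_ncard_ne_zero (by omega)
  have hc : Nat.card (D \ {x} : Set α) = r := by
    rw [Nat.card_coe_set_eq, Set.ncard_sdiff_singleton_of_mem hx, hD]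
    omega
  have := (hfin.sdiff (t := {x})).to_subtype
  let f := (Finite.equivFinOfCardEq hc).symm
  refine ⟨Fin.cons x fun b => (f b : α), fun b hb => ?_, ?_⟩
  · obtain rfl : b = 0 := Fin.ext hb
    rfl
  · rw [Fin.range_cons, show (fun b => (f b : α)) = Subtype.val ∘ f from rfl,
      f.surjective.range_comp, Subtype.range_coe]
    simp [Set.insert_eq_of_mem hx]

/-- This exact count later turns a surjection from the vertices of `uStar` into a bijection. -/
theorem IsUnicyclic.ncard_eq {H : Hypergraph α} {k : ℕ} (hk : 1 ≤ k) (h : H.IsUnicyclic k) :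
    V(H).ncard = (k - 1) * E(H).ncard := by
  have := h.2.2
  zify [hk]
  push_cast at this
  linarith

theorem IsHypercycle.le_ncard {H : Hypergraph α} [Finite V(H)] {q : ℕ} {v : Fin q → α}
    {e : Fin q → Set α} (h : H.IsHypercycle q v e) : q ≤ E(H).ncard := by
  have h1 : (Set.range e).ncard = q := by
    rw [← Set.image_univ, Set.ncard_image_of_injective _ h.edge_injective, Set.ncard_univ,
      Nat.card_fin]
  rw [← h1]
  refine Set.ncard_le_ncard ?_ H.finite_edgeSet
  rintro _ ⟨i, rfl⟩
  exact h.edge_mem i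

/-- The edges of `uStar`. -/
def uStarEdge (k g p : ℕ) : Fin g ⊕ Fin p → Set (UStarVertex k g p) :=
  Sum.elim (uStarCycleEdge k g p) (uStarPendantEdge k g p)

theorem image_uStarCycleEdge {k g p : ℕ} (hk : 2 ≤ k) (φ : UStarVertex k g p → α) (i : Fin g) :
    φ '' uStarCycleEdge k g p i =
      insert (φ (Sum.inl (finRotate g i, ⟨0, by omega⟩)))
        (Set.range fun b => φ (Sum.inl (i, b))) := by
  ext x
  simp only [uStarCycleEdge, Set.mem_image, Set.mem_ofPred_eq, Set.mem_insert_iff, Set.mem_range]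
  constructor
  · rintro ⟨y, ⟨b, rfl⟩ | ⟨b, hb, rfl⟩, rfl⟩
    · exact Or.inr ⟨b, rfl⟩
    · left
      rw [show b = ⟨0, by omega⟩ from Fin.ext hb]
  · rintro (rfl | ⟨b, rfl⟩)
    · exact ⟨_, Or.inr ⟨_, rfl, rfl⟩, rfl⟩
    · exact ⟨_, Or.inl ⟨b, rfl⟩, rfl⟩

theorem image_uStarPendantEdge {k g p : ℕ} (hk : 2 ≤ k) (hg : 0 < g) (φ : UStarVertex k g p → α)
    (j : Fin p) :
    φ '' uStarPendantEdge k g p j =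
      insert (φ (Sum.inl (⟨0, hg⟩, ⟨0, by omega⟩))) (Set.range fun b => φ (Sum.inr (j, b))) := by
  ext x
  simp only [uStarPendantEdge, Set.mem_image, Set.mem_ofPred_eq, Set.mem_insert_iff, Set.mem_range]
  constructor
  · rintro ⟨y, ⟨a, b, ha, hb, rfl⟩ | ⟨b, rfl⟩, rfl⟩
    · left
      rw [show a = ⟨0, hg⟩ from Fin.ext ha, show b = ⟨0, by omega⟩ from Fin.ext hb]
    · exact Or.inr ⟨b, rfl⟩
  · rintro (rfl | ⟨b, rfl⟩)
    · exact ⟨_, Or.inl ⟨_, _, rfl, rfl, rfl⟩, rfl⟩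
    · exact ⟨_, Or.inr ⟨b, rfl⟩, rfl⟩

theorem card_uStarVertex (k g p : ℕ) : Nat.card (UStarVertex k g p) = (k - 1) * (g + p) := by
  simp
  ring

/-- A unicyclic hypergraph turns into `uStar` by moving edges to a prescribed vertex. -/
theorem IsUnicyclic.exists_move {G : Hypergraph α} [Finite V(G)] {k g p : ℕ} (hk : 3 ≤ k)
    (hG : G.IsUnicyclic k) {v : Fin g → α} {e : Fin g → Set α} (hcyc : G.IsHypercycle g v e)
    (hp : g + p = E(G).ncard) {w : α} (hw : w ∈ V(G)) :
    ∃ (s : Fin g ⊕ Fin p → Set α) (φ : UStarVertex k g p → α),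
      G.IsEdgeFamily s ∧ Set.BijOn φ Set.univ V(G) ∧
      ∀ t, φ '' uStarEdge k g p t = s t ∨
        w ∉ s t ∧ ∃ z ∈ s t, φ '' uStarEdge k g p t = insert w (s t \ {z}) := by
  classical
  have hg0 : 0 < g := by have := hcyc.two_le; omega
  have hVfin : V(G).Finite := Set.toFinite _
  obtain ⟨d, hdw, hd⟩ := hG.2.1.exists_rank hw
  -- a vertex `u` of the hypercycle nearest to `w`
  obtain ⟨u, huC, humin⟩ : ∃ u ∈ ⋃ i, e i, ∀ y ∈ ⋃ i, e i, d u ≤ d y := by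
    have hne : (⋃ i, e i).Nonempty :=
      ⟨v ⟨0, hg0⟩, Set.mem_iUnion.2 ⟨⟨0, hg0⟩, hcyc.left_mem _⟩⟩
    exact ⟨Function.argminOn d _ hne, Function.argminOn_mem d _ hne,
      fun y hy => Function.argminOn_le d _ hy⟩
  -- The edge is chosen so that `u` is not its right end: `u` can then give way to `w` while the
  -- link to the next edge survives. Rotation puts this edge at index `0`.
  obtain ⟨a, hua, hune⟩ : ∃ a, u ∈ e a ∧ u ≠ v (finRotate g a) := by
    obtain ⟨i, hi⟩ := Set.mem_iUnion.1 huC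
    exact hcyc.exists_mem_ne hi
  set o : Fin g := ⟨0, hg0⟩ with ho
  obtain ⟨v', e', hcyc', hrange, heo, hvo⟩ := hcyc.rotate a o
  rw [← heo] at hua
  rw [← hvo] at hune
  replace humin : ∀ i, ∀ y ∈ e' i, d u ≤ d y := by
    intro i y hy
    obtain ⟨j, hj⟩ := hrange ▸ Set.mem_range_self i
    exact humin y (Set.mem_iUnion.2 ⟨j, hj ▸ hy⟩)
  clear hvo heo hrange huC a hcyc
  clear v e
  rename' v' => v, e' => e, hcyc' => hcyc
  -- If `u ≠ w`, some vertex has smaller rank than `u`, so `u` has positive rank; as `w` has rank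
  -- `0`, minimality of `u` keeps `w` off the hypercycle.
  have hwu : ∀ i, w ∈ e i → w = u := by
    intro i hi
    by_contra hne
    obtain ⟨-, -, -, y, -, hy⟩ := hd u ((hcyc.edge_mem o).subset_vertexSet hua) (Ne.symm hne)
    have := humin i w hi
    omega
  -- the remaining edges
  have hfin : (E(G) \ Set.range e).Finite := G.finite_edgeSet.sdiff
  have hcard : Nat.card (E(G) \ Set.range e : Set (Set α)) = p := by
    have hsub : Set.range e ⊆ E(G) := by
      rintro _ ⟨i, rfl⟩
      exact hcyc.edge_mem i
    rw [Nat.card_coe_set_eq, Set.ncard_sdiff hsub (Set.finite_range e), ← Set.image_univ,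
      Set.ncard_image_of_injective _ hcyc.edge_injective, Set.ncard_univ, Nat.card_fin]
    omega
  have := hfin.to_subtype
  let f := (Finite.equivFinOfCardEq hcard).symm
  have hfE : ∀ j, (f j : Set α) ∈ E(G) := fun j => (f j).2.1
  have hpar : ∀ j, ∃ x ∈ (f j : Set α), ∀ y ∈ (f j : Set α), d x ≤ d y := by
    intro j
    have hne : (f j : Set α).Nonempty := Set.nonempty_of_ncard_ne_zero (by
      rw [hG.1 _ (hfE j)]
      omega)
    exact ⟨Function.argminOn d _ hne, Function.argminOn_mem d _ hne,
      fun y hy => Function.argminOn_le d _ hy⟩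
  choose r hrf hrmin using hpar
  have hwr : ∀ j, w ∈ (f j : Set α) → w = r j := by
    intro j hj
    by_contra hne
    obtain ⟨-, -, -, y, -, hy⟩ := hd (r j) ((hfE j).subset_vertexSet (hrf j)) (Ne.symm hne)
    have := hrmin j w hj
    omega
  -- the enumerations defining `φ`
  have hfinE : ∀ s ∈ E(G), s.Finite := fun s hs => hVfin.subset hs.subset_vertexSet
  -- `D i` is the block of `k - 1` vertices assigned to the `i`-th cycle edge: `e i` without its
  -- right end, which is left to the next block. In block `o` the vertex `u` gives way to `w`. The
  -- cycle vertex of the block is `c i`.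
  let D : Fin g → Set α := fun i =>
    if i = o then insert w (e i \ {v (finRotate g i), u}) else e i \ {v (finRotate g i)}
  let c : Fin g → α := fun i => if i = o then w else v i
  have hcD : ∀ i, c i ∈ D i := by
    intro i
    by_cases hi : i = o
    · simp [c, D, hi]
    · simp only [c, D, if_neg hi]
      exact ⟨hcyc.left_mem i, fun h => hcyc.next_ne i h.symm⟩
  have hDcard : ∀ i, (D i).ncard = k - 1 := by
    intro i
    by_cases hi : i = o
    · subst hi
      simp only [D, if_pos rfl]
      rw [Set.ncard_insert_of_notMem _ ((hfinE _ (hcyc.edge_mem _)).sdiff),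
        Set.ncard_sdiff _ (Set.toFinite _), hG.1 _ (hcyc.edge_mem _), Set.ncard_pair hune.symm]
      · omega
      · rintro x (rfl | rfl)
        · exact hcyc.right_mem _
        · exact hua
      · rintro ⟨h1, h2⟩
        exact h2 (Or.inr (hwu _ h1))
    · simp only [D, if_neg hi]
      rw [Set.ncard_sdiff_singleton_of_mem (hcyc.right_mem i), hG.1 _ (hcyc.edge_mem _)]
  choose h hh0 hhr using fun i => exists_enumeration (hcD i) (by omega) (hDcard i)
  have hFcard : ∀ j, ((f j : Set α) \ {r j}).ncard = k - 1 := by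
    intro j
    rw [Set.ncard_sdiff_singleton_of_mem (hrf j), hG.1 _ (hfE j)]
  have hF : ∀ j, ∃ h : Fin (k - 1) → α, Set.range h = (f j : Set α) \ {r j} := by
    intro j
    obtain ⟨x, hx⟩ := Set.nonempty_of_ncard_ne_zero (s := (f j : Set α) \ {r j}) (by
      rw [hFcard]
      omega)
    obtain ⟨h, -, hh⟩ := exists_enumeration hx (by omega) (hFcard j)
    exact ⟨h, hh⟩
  choose h' hhr' using hF
  let φ : UStarVertex k g p → α := Sum.elim (fun x => h x.1 x.2) (fun x => h' x.1 x.2)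
  have hφcyc : ∀ i, φ '' uStarCycleEdge k g p i = insert (c (finRotate g i)) (D i) := by
    intro i
    rw [image_uStarCycleEdge (by omega)]
    simp only [φ, Sum.elim_inl]
    rw [hh0 _ _ rfl, hhr]
  have hφpen : ∀ j, φ '' uStarPendantEdge k g p j = insert w ((f j : Set α) \ {r j}) := by
    intro j
    rw [image_uStarPendantEdge (by omega) hg0]
    simp only [φ, Sum.elim_inl, Sum.elim_inr]
    rw [hh0 _ _ rfl, hhr']
    simp [c, o]
  refine ⟨Sum.elim e fun j => f j, φ, ⟨?_, ?_⟩, ?_, ?_⟩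
  · refine hcyc.edge_injective.sumElim (Subtype.val_injective.comp f.injective) fun i j hij => ?_
    exact (f j).2.2 ⟨i, hij⟩
  · rw [Set.Sum.elim_range, show (fun j => (f j : Set α)) = Subtype.val ∘ f from rfl,
      f.surjective.range_comp, Subtype.range_coe, Set.union_sdiff_self, Set.union_eq_right]
    rintro _ ⟨i, rfl⟩
    exact hcyc.edge_mem i
  · have himg : φ '' Set.univ = V(G) := by
      rw [Set.image_univ]
      refine Set.Subset.antisymm ?_ fun x hx => ?_
      · rintro _ ⟨⟨i, b⟩ | ⟨j, b⟩, rfl⟩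
        · have h1 : h i b ∈ D i := hhr i ▸ Set.mem_range_self b
          change h i b ∈ V(G)
          by_cases hi : i = o
          · simp only [D, if_pos hi] at h1
            obtain h1 | h1 := h1
            · rwa [h1]
            · exact (hcyc.edge_mem i).subset_vertexSet h1.1
          · simp only [D, if_neg hi] at h1
            exact (hcyc.edge_mem i).subset_vertexSet h1.1
        · have h1 : h' j b ∈ (f j : Set α) \ {r j} := hhr' j ▸ Set.mem_range_self b
          exact (hfE j).subset_vertexSet h1.1
      · by_cases hxw : x = w
        · exact ⟨Sum.inl (o, ⟨0, by omega⟩), by simp [φ, hh0, c, hxw]⟩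
        -- In an edge where `x` has a neighbour of smaller rank, `x` is not the nearest vertex that
        -- gets removed, so it survives in some block.
        · obtain ⟨s, hs, hxs, y, hys, hyx⟩ := hd x hx hxw
          by_cases hsr : s ∈ Set.range e
          · obtain ⟨i, rfl⟩ := hsr
            have hxu : x ≠ u := by
              rintro rfl
              have := humin i y hys
              omega
            obtain ⟨j, hxj, hxn⟩ := hcyc.exists_mem_ne hxs
            have hxD : x ∈ D j := by
              by_cases hj : j = o
              · simp only [D, if_pos hj]
                exact Or.inr ⟨hxj, by simp [-finRotate_apply, hxn, hxu]⟩
              · simp only [D, if_neg hj]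
                exact ⟨hxj, hxn⟩
            rw [← hhr] at hxD
            obtain ⟨b, hb⟩ := hxD
            exact ⟨Sum.inl (j, b), hb⟩
          · obtain ⟨j, hj⟩ := f.surjective ⟨s, hs, hsr⟩
            have hjs : (f j : Set α) = s := by rw [hj]
            have hxF : x ∈ (f j : Set α) \ {r j} := by
              refine ⟨hjs ▸ hxs, ?_⟩
              rintro rfl
              have := hrmin j y (hjs ▸ hys)
              omega
            rw [← hhr'] at hxF
            obtain ⟨b, hb⟩ := hxF
            exact ⟨Sum.inr (j, b), hb⟩
    refine ⟨fun x hx => himg ▸ Set.mem_image_of_mem φ hx, ?_, himg.ge⟩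
    -- Injectivity comes from surjectivity, both sides having `(k - 1) * (g + p)` vertices.
    rw [← Set.ncard_image_iff, himg, Set.ncard_univ, card_uStarVertex,
      hG.ncard_eq (by omega), hp]
  · rintro (i | j)
    · simp only [uStarEdge, Sum.elim_inl, hφcyc]
      by_cases hi : i = o
      · subst hi
        have h1 : insert (c (finRotate g o)) (D o) = insert w (e o \ {u}) := by
          simp only [c, D, if_pos, if_neg (finRotate_ne_self hcyc.two_le o)]
          ext x
          have := hcyc.right_mem o
          simp only [Set.mem_insert_iff, Set.mem_sdiff, Set.mem_singleton_iff]
          by_cases hx : x = v (finRotate g o)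
          · subst hx
            simp [-finRotate_apply, this, hune.symm]
          · simp [-finRotate_apply, hx]
        rw [h1]
        by_cases hwo : w ∈ e o
        · left
          rw [← hwu o hwo, Set.insert_sdiff_singleton, Set.insert_eq_of_mem hwo]
        · exact Or.inr ⟨hwo, u, hua, rfl⟩
      · simp only [D, if_neg hi]
        -- Besides `e o`, only the cycle edge preceding it can change: its right end `v o` becomes
        -- `w`, closing the cycle there.
        by_cases hr : finRotate g i = o
        · simp only [c, hr, if_pos]
          have hvo : v o ∈ e i := hr ▸ hcyc.right_mem i
          by_cases hwi : w ∈ e i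
          · left
            -- Here `w = u` lies in both `e o` and `e i`, so it is an end of `e o`, and the right
            -- end was excluded.
            have hwv : w = v o := by
              have h1 : w ∈ e o ∩ e i := ⟨hwu i hwi ▸ hua, hwi⟩
              rw [hcyc.inter_eq o i (Ne.symm hi)] at h1
              obtain h2 | h2 := h1.1
              · exact h2
              · exact absurd ((hwu i hwi).symm.trans h2) hune
            rw [hwv, Set.insert_sdiff_singleton, Set.insert_eq_of_mem hvo]
          · exact Or.inr ⟨hwi, v o, hvo, rfl⟩
        · left
          simp only [c, if_neg hr]
          rw [Set.insert_sdiff_singleton, Set.insert_eq_of_mem (hcyc.right_mem i)]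
    · simp only [uStarEdge, Sum.elim_inr, hφpen]
      by_cases hwj : w ∈ (f j : Set α)
      · left
        rw [← hwr j hwj, Set.insert_sdiff_singleton, Set.insert_eq_of_mem hwj]
      · exact Or.inr ⟨hwj, r j, hrf j, rfl⟩

end Hypergraph

/-! ### `uStar` is unicyclic of girth `g`. -/

namespace Hypergraph

section UStarEdges

variable {k g p : ℕ}

theorem inl_mem_uStarCycleEdge {a i : Fin g} {b : Fin (k - 1)} :
    Sum.inl (a, b) ∈ uStarCycleEdge k g p i ↔ a = i ∨ b.val = 0 ∧ a = finRotate g i := by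
  simp only [uStarCycleEdge, Set.mem_ofPred_eq, Sum.inl.injEq, Prod.mk.injEq]
  constructor
  · rintro (⟨b', rfl, rfl⟩ | ⟨b', hb, rfl, rfl⟩)
    · exact Or.inl rfl
    · exact Or.inr ⟨hb, rfl⟩
  · rintro (rfl | ⟨hb, rfl⟩)
    · exact Or.inl ⟨b, rfl, rfl⟩
    · exact Or.inr ⟨b, hb, rfl, rfl⟩

theorem inr_notMem_uStarCycleEdge {i : Fin g} {x : Fin p × Fin (k - 1)} :
    Sum.inr x ∉ uStarCycleEdge k g p i := by
  simp [uStarCycleEdge]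

theorem inl_mem_uStarPendantEdge {a : Fin g} {b : Fin (k - 1)} {j : Fin p} :
    Sum.inl (a, b) ∈ uStarPendantEdge k g p j ↔ a.val = 0 ∧ b.val = 0 := by
  simp only [uStarPendantEdge, Set.mem_ofPred_eq, Sum.inl.injEq, Prod.mk.injEq, reduceCtorEq,
    exists_false, or_false]
  constructor
  · rintro ⟨a', b', ha, hb, rfl, rfl⟩
    exact ⟨ha, hb⟩
  · rintro ⟨ha, hb⟩
    exact ⟨a, b, ha, hb, rfl, rfl⟩

theorem inr_mem_uStarPendantEdge {i j : Fin p} {b : Fin (k - 1)} :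
    Sum.inr (i, b) ∈ uStarPendantEdge k g p j ↔ i = j := by
  simp only [uStarPendantEdge, Set.mem_ofPred_eq, Sum.inr.injEq, Prod.mk.injEq, reduceCtorEq,
    and_false, exists_false, false_or]
  constructor
  · rintro ⟨b', rfl, -⟩
    rfl
  · rintro rfl
    exact ⟨b, rfl, rfl⟩

/-- Index `1` gives a vertex private to its edge. It exists because `k ≥ 3`; for `k = g = 2` the two
cycle edges would coincide. -/
theorem uStarCycleEdge_injective (hk : 3 ≤ k) : Function.Injective (uStarCycleEdge k g p) := by
  intro i j hij
  have h : Sum.inl (i, ⟨1, by omega⟩) ∈ uStarCycleEdge k g p i :=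
    inl_mem_uStarCycleEdge.2 (Or.inl rfl)
  rw [hij, inl_mem_uStarCycleEdge] at h
  simpa using h

theorem uStarEdge_injective (hk : 3 ≤ k) : Function.Injective (uStarEdge k g p) := by
  refine (uStarCycleEdge_injective hk).sumElim (fun i j hij => ?_) fun i j hij => ?_
  · have h : Sum.inr (i, ⟨0, by omega⟩) ∈ uStarPendantEdge k g p i :=
      inr_mem_uStarPendantEdge.2 rfl
    rwa [hij, inr_mem_uStarPendantEdge] at h
  · have h : Sum.inr (j, ⟨0, by omega⟩) ∈ uStarPendantEdge k g p j :=
      inr_mem_uStarPendantEdge.2 rfl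
    rw [← hij] at h
    exact inr_notMem_uStarCycleEdge h

theorem ncard_uStarEdge (hk : 2 ≤ k) (hg : 2 ≤ g) (t : Fin g ⊕ Fin p) :
    (uStarEdge k g p t).ncard = k := by
  have key : ∀ (x : UStarVertex k g p) (f : Fin (k - 1) → UStarVertex k g p),
      Function.Injective f → x ∉ Set.range f → (insert x (Set.range f)).ncard = k := by
    intro x f hf hx
    rw [Set.ncard_insert_of_notMem hx, ← Set.image_univ, Set.ncard_image_of_injective _ hf,
      Set.ncard_univ, Nat.card_fin]
    omega
  obtain i | j := t
  · rw [uStarEdge, Sum.elim_inl, ← Set.image_id (uStarCycleEdge k g p i),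
      image_uStarCycleEdge (by omega)]
    refine key _ _ (fun b b' h => by simpa using h) ?_
    rintro ⟨b, hb⟩
    simp only [id, Sum.inl.injEq, Prod.mk.injEq] at hb
    exact finRotate_ne_self hg i hb.1.symm
  · rw [uStarEdge, Sum.elim_inr, ← Set.image_id (uStarPendantEdge k g p j),
      image_uStarPendantEdge (by omega) (by omega)]
    refine key _ _ (fun b b' h => by simpa using h) ?_
    rintro ⟨b, hb⟩
    simp at hb

end UStarEdges

section UStar

variable {n k g : ℕ}

theorem uStar_isEdgeFamily (hk : 3 ≤ k) :
    (uStar n k g).IsEdgeFamily (uStarEdge k g (n / (k - 1) - g)) :=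
  ⟨uStarEdge_injective hk, Set.Sum.elim_range _ _⟩

theorem uStar_isUniform (hk : 3 ≤ k) (hg : 2 ≤ g) : (uStar n k g).IsUniform k := by
  intro e he
  rw [← (uStar_isEdgeFamily hk).range_eq] at he
  obtain ⟨t, rfl⟩ := he
  exact ncard_uStarEdge (by omega) hg t

theorem ncard_vertexSet_uStar (hn : k - 1 ∣ n) (hgn : g ≤ n / (k - 1)) :
    V(uStar n k g).ncard = n := by
  rw [uStar, Set.ncard_univ, card_uStarVertex, Nat.add_sub_cancel' hgn, Nat.mul_div_cancel' hn]

theorem ncard_edgeSet_uStar (hk : 3 ≤ k) (hgn : g ≤ n / (k - 1)) :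
    E(uStar n k g).ncard = n / (k - 1) := by
  rw [← (uStar_isEdgeFamily hk).range_eq, ← Set.image_univ,
    Set.ncard_image_of_injective _ (uStarEdge_injective hk), Set.ncard_univ]
  simp
  omega

theorem uStar_isConnected (hk : 3 ≤ k) (hg : 2 ≤ g) : (uStar n k g).IsConnected := by
  have hmem := (uStar_isEdgeFamily (n := n) (g := g) hk).mem
  set x₀ : UStarVertex k g (n / (k - 1) - g) := Sum.inl (⟨0, by omega⟩, ⟨0, by omega⟩) with hx₀
  have hcyc : ∀ m (hm : m < g), Relation.ReflTransGen (uStar n k g).Adj x₀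
      (Sum.inl (⟨m, hm⟩, ⟨0, by omega⟩)) := by
    intro m
    induction m with
    | zero => exact fun _ => .refl
    | succ m ih =>
      intro hm
      refine (ih (by omega)).tail ⟨_, hmem (Sum.inl ⟨m, by omega⟩), ?_, ?_⟩
      · exact inl_mem_uStarCycleEdge.2 (Or.inl rfl)
      · refine inl_mem_uStarCycleEdge.2 (Or.inr ⟨rfl, ?_⟩)
        obtain ⟨q, rfl⟩ : ∃ q, g = q + 1 := ⟨g - 1, by omega⟩
        rw [finRotate_of_lt (by omega)]
  have hall : ∀ x, Relation.ReflTransGen (uStar n k g).Adj x₀ x := by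
    rintro (⟨i, b⟩ | ⟨j, b⟩)
    · exact (hcyc i.1 i.2).tail ⟨_, hmem (Sum.inl i), inl_mem_uStarCycleEdge.2 (Or.inl rfl),
        inl_mem_uStarCycleEdge.2 (Or.inl rfl)⟩
    · exact .single ⟨_, hmem (Sum.inr j), inl_mem_uStarPendantEdge.2 ⟨rfl, rfl⟩,
        inr_mem_uStarPendantEdge.2 rfl⟩
  have : Std.Symm (uStar n k g).Adj := ⟨fun _ _ h => h.symm⟩
  exact ⟨⟨x₀, trivial⟩, fun x _ y _ => (Relation.ReflTransGen.stdSymm.symm _ _ (hall x)).trans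
    (hall y)⟩

theorem uStar_isUnicyclic (hk : 3 ≤ k) (hg : 2 ≤ g) (hn : k - 1 ∣ n) (hgn : g ≤ n / (k - 1)) :
    (uStar n k g).IsUnicyclic k := by
  refine ⟨uStar_isUniform hk hg, uStar_isConnected hk hg, ?_⟩
  rw [ncard_vertexSet_uStar hn hgn, ncard_edgeSet_uStar hk hgn]
  obtain ⟨m, rfl⟩ := hn
  rw [Nat.mul_div_cancel_left _ (by omega)]
  push_cast [Nat.cast_sub (show 1 ≤ k by omega)]
  ring

theorem uStar_isHypercycle (hk : 3 ≤ k) (hg : 2 ≤ g) :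
    (uStar n k g).IsHypercycle g (fun i => Sum.inl (i, ⟨0, by omega⟩))
      (uStarCycleEdge k g (n / (k - 1) - g)) := by
  refine ⟨hg, fun i j h => by simpa using h, uStarCycleEdge_injective hk,
    fun i => Or.inl ⟨i, rfl⟩, fun i => inl_mem_uStarCycleEdge.2 (Or.inl rfl),
    fun i => inl_mem_uStarCycleEdge.2 (Or.inr ⟨rfl, rfl⟩), fun i j hij => ?_⟩
  ext x
  obtain ⟨a, b⟩ | x := x
  · have hr : finRotate g i ≠ finRotate g j := (finRotate g).injective.ne hij
    simp only [Set.mem_inter_iff, inl_mem_uStarCycleEdge, Set.mem_insert_iff,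
      Set.mem_singleton_iff, Sum.inl.injEq, Prod.mk.injEq, Fin.ext_iff (a := b)]
    constructor
    · rintro ⟨rfl | ⟨hb, rfl⟩, h | ⟨hb', h⟩⟩
      · exact absurd h hij
      · simp [hb', h]
      · simp [hb, h]
      · exact absurd h hr
    · rintro ⟨⟨rfl, hb⟩ | ⟨rfl, hb⟩, ⟨h, -⟩ | ⟨h, -⟩⟩
      · exact absurd h hij
      · exact ⟨Or.inl rfl, Or.inr ⟨hb, h⟩⟩
      · exact ⟨Or.inr ⟨hb, rfl⟩, Or.inl h⟩
      · exact absurd h hr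
  · simp [inr_notMem_uStarCycleEdge]

/-- A vertex in two edges of `uStar` is a cycle vertex. -/
theorem eq_inl_zero_of_mem_uStarEdge {p : ℕ} {s t : Fin g ⊕ Fin p} (hst : s ≠ t)
    {x : UStarVertex k g p} (hs : x ∈ uStarEdge k g p s) (ht : x ∈ uStarEdge k g p t) :
    ∃ (a : Fin g) (b : Fin (k - 1)), b.val = 0 ∧ x = Sum.inl (a, b) := by
  obtain ⟨a, b⟩ | ⟨j, b⟩ := x
  · refine ⟨a, b, ?_, rfl⟩
    obtain i | i := s
    · obtain j | j := t
      · simp only [uStarEdge, Sum.elim_inl, inl_mem_uStarCycleEdge] at hs ht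
        obtain rfl | h := hs
        · obtain rfl | h := ht
          · exact absurd rfl hst
          · exact h.1
        · exact h.1
      · exact (inl_mem_uStarPendantEdge.1 ht).2
    · exact (inl_mem_uStarPendantEdge.1 hs).2
  · obtain i | i := s
    · exact absurd hs inr_notMem_uStarCycleEdge
    · obtain i' | i' := t
      · exact absurd ht inr_notMem_uStarCycleEdge
      · rw [← inr_mem_uStarPendantEdge.1 hs, ← inr_mem_uStarPendantEdge.1 ht] at hst
        exact absurd rfl hst

/-- Every hypercycle of `uStar` runs through all cycle edges. -/
theorem le_of_isHypercycle_uStar (hk : 3 ≤ k) (hg : 2 ≤ g) {q : ℕ}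
    {v : Fin q → UStarVertex k g (n / (k - 1) - g)}
    {e : Fin q → Set (UStarVertex k g (n / (k - 1) - g))}
    (h : (uStar n k g).IsHypercycle q v e) : g ≤ q := by
  have hE : ∀ i, ∃ t, uStarEdge k g _ t = e i := fun i => by
    have := h.edge_mem i
    rwa [← (uStar_isEdgeFamily hk).range_eq] at this
  choose τ hτ using hE
  have hτinj : Function.Injective τ := fun i j hij => h.edge_injective (by rw [← hτ, ← hτ, hij])
  -- both cycle vertices of an edge of the hypercycle lie on a neighbouring edge
  have hnext : ∀ i, ∃ j, j ≠ i ∧ v (finRotate q i) ∈ e j := fun i =>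
    ⟨finRotate q i, finRotate_ne_self h.two_le i, h.left_mem _⟩
  have hprev : ∀ i, ∃ j, j ≠ i ∧ v i ∈ e j := fun i => by
    refine ⟨(finRotate q).symm i, fun hi => finRotate_ne_self h.two_le i ?_, ?_⟩
    · conv_lhs => rw [← hi]
      exact Equiv.apply_symm_apply _ _
    · have h1 := h.right_mem ((finRotate q).symm i)
      rwa [Equiv.apply_symm_apply] at h1
  have hshared : ∀ i x, x ∈ e i → (∃ j, j ≠ i ∧ x ∈ e j) →
      ∃ (a : Fin g) (b : Fin (k - 1)), b.val = 0 ∧ x = Sum.inl (a, b) := by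
    rintro i x hx ⟨j, hji, hxj⟩
    rw [← hτ] at hx hxj
    exact eq_inl_zero_of_mem_uStarEdge (hτinj.ne hji) hxj hx
  -- An edge of a hypercycle shares two distinct vertices with others, while a pendant edge contains
  -- only one cycle vertex.
  have hcyc : ∀ i, ∃ a, τ i = Sum.inl a := by
    intro i
    obtain ⟨a, b, hb, hab⟩ := hshared i _ (h.left_mem i) (hprev i)
    obtain ⟨a', b', hb', hab'⟩ := hshared i _ (h.right_mem i) (hnext i)
    cases hi : τ i with
    | inl a => exact ⟨a, rfl⟩
    | inr j =>
      have h1 := h.left_mem i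
      have h2 := h.right_mem i
      rw [← hτ, hi, hab] at h1
      rw [← hτ, hi, hab'] at h2
      replace h1 := inl_mem_uStarPendantEdge.1 h1
      replace h2 := inl_mem_uStarPendantEdge.1 h2
      refine absurd ?_ (h.next_ne i)
      rw [hab, hab', Fin.ext (h1.1.trans h2.1.symm), Fin.ext (h1.2.trans h2.2.symm)]
  choose a ha using hcyc
  -- Of the two shared vertices of `e i`, one is not the left end of its cycle edge, hence is the
  -- right end. Another hypercycle edge through it can only be the following cycle edge.
  have hstep : ∀ i, ∃ j, a j = finRotate g (a i) := by
    intro i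
    have key : ∀ x, x ∈ e i → (∃ j, j ≠ i ∧ x ∈ e j) →
        (∀ b : Fin (k - 1), b.val = 0 → x ≠ Sum.inl (a i, b)) →
        ∃ j, a j = finRotate g (a i) := by
      rintro x hx ⟨j, hji, hxj⟩ hne
      obtain ⟨c, b, hb, rfl⟩ := hshared i x hx ⟨j, hji, hxj⟩
      rw [← hτ, ha] at hx hxj
      have hx1 := inl_mem_uStarCycleEdge.1 hx
      have hx2 := inl_mem_uStarCycleEdge.1 hxj
      obtain rfl | ⟨-, rfl⟩ := hx1
      · exact absurd rfl (hne b hb)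
      · obtain hj | ⟨-, hj⟩ := hx2
        · exact ⟨j, hj.symm⟩
        · refine absurd (hτinj ?_) hji
          rw [ha, ha, (finRotate g).injective hj]
    by_cases hv : ∃ b : Fin (k - 1), b.val = 0 ∧ v i = Sum.inl (a i, b)
    · obtain ⟨b, hb, hvi⟩ := hv
      refine key _ (h.right_mem i) (hnext i) fun b' hb' hv' => h.next_ne i ?_
      rw [hv', hvi, Fin.ext (hb'.trans hb.symm)]
    · push Not at hv
      exact key _ (h.left_mem i) (hprev i) hv
  -- The indices used are closed under `finRotate g`, a single cycle moving every index, so all `g`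
  -- of them occur.
  have hsurj : Function.Surjective a := by
    have h0 : 0 < q := by have := h.two_le; omega
    have h1 : ∀ m : ℕ, ∃ j, a j = (finRotate g ^ m) (a ⟨0, h0⟩) := by
      intro m
      induction m with
      | zero => exact ⟨_, rfl⟩
      | succ m ih =>
        obtain ⟨j, hj⟩ := ih
        obtain ⟨j', hj'⟩ := hstep j
        exact ⟨j', by rw [hj', hj, pow_succ', Equiv.Perm.mul_apply]⟩
    intro c
    have hrot : (finRotate g).IsCycle := by
      obtain ⟨m, rfl⟩ : ∃ m, g = m + 2 := ⟨g - 2, by omega⟩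
      exact isCycle_finRotate
    obtain ⟨m, hm⟩ := hrot.exists_pow_eq (finRotate_ne_self hg (a ⟨0, h0⟩)) (finRotate_ne_self hg c)
    obtain ⟨j, hj⟩ := h1 m
    exact ⟨j, hj.trans hm⟩
  simpa using Fintype.card_le_of_surjective a hsurj

theorem uStar_hasGirth (hk : 3 ≤ k) (hg : 2 ≤ g) : (uStar n k g).HasGirth g :=
  ⟨⟨_, _, uStar_isHypercycle hk hg⟩, fun _ ⟨_, _, h⟩ => le_of_isHypercycle_uStar hk hg h⟩

end UStar

end Hypergraph

theorem theorem1p3 {α : Type*} (n k g : ℕ) (hk : 3 ≤ k)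
    (G : Hypergraph α) [Finite V(G)]
    (hG : G.IsUnicyclic k) (hn : V(G).ncard = n) (hg : G.HasGirth g) :
    ((Hypergraph.uStar n k g).IsUnicyclic k ∧
      V(Hypergraph.uStar n k g).ncard = n ∧
      (Hypergraph.uStar n k g).HasGirth g) ∧
    G.specRadius ≤ (Hypergraph.uStar n k g).specRadius ∧
    (G.specRadius = (Hypergraph.uStar n k g).specRadius ↔
      G.IsIsomorphic (Hypergraph.uStar n k g)) := by
  obtain ⟨v, e, hcyc⟩ := hg.1
  have hm : n = (k - 1) * E(G).ncard := hn ▸ hG.ncard_eq (by omega)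
  have hdiv : n / (k - 1) = E(G).ncard := by rw [hm, Nat.mul_div_cancel_left _ (by omega)]
  have hgn : g ≤ n / (k - 1) := hdiv ▸ hcyc.le_ncard
  have hdvd : k - 1 ∣ n := ⟨_, hm⟩
  have hU := Hypergraph.uStar_isUniform (n := n) hk hcyc.two_le
  obtain ⟨w, hw, hmove⟩ :=
    Hypergraph.exists_vertex_specRadius_le (by omega : 2 ≤ k) hG.1 hG.2.1 hU
  obtain ⟨s, φ, hs, hφ, hsφ⟩ := hG.exists_move hk hcyc
    (by omega : g + (n / (k - 1) - g) = E(G).ncard) hw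
  obtain ⟨hle, heq⟩ := hmove _ inferInstance s _ φ hs (Hypergraph.uStar_isEdgeFamily hk) hφ hsφ
  exact ⟨⟨Hypergraph.uStar_isUnicyclic hk hcyc.two_le hdvd hgn,
    Hypergraph.ncard_vertexSet_uStar hdvd hgn, Hypergraph.uStar_hasGirth hk hcyc.two_le⟩,
    hle, heq, fun h => h.specRadius_eq hG.1 hU⟩
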